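/- Let $n,L\ge 0$ and let $H_1,\dots,H_L$ be operators on $n$ qubits, each of which is a real multiple of a tensor product of $n$ single-qubit Pauli matrices $I,X,Y,Z$. Let $\|\cdot\|$ be the spectral norm, $\Lambda:=\max_j\|H_j\|$ (with $\Lambda:=0$ if $L=0$), $p:=1/(4-4^{1/3})$, and for $\mu\in\mathbb C$ let $$S_2(\mu):=e^{\mu H_1/2}\cdots e^{\mu H_L/2}\,e^{\mu H_L/2}\cdots e^{\mu H_1/2},\qquad S_4(\mu):=S_2(p\mu)^2\,S_2((1-4p)\mu)\,S_2(p\mu)^2 .$$ Define the augmented list $\tilde H_1,\dots,\tilde H_{10L}$ as five consecutive copies of $H_1,\dots,H_L,H_L,\dots,H_1$, that is, for $h\in\{0,1,2,3,4\}$, $$\tilde H_j=\begin{cases}H_{j-2hL}, & 2hL+1\le j\le(2h+1)L,\\ H_{2(h+1)L-j+1}, & (2h+1)L+1\le j\le 2(h+1)L.\end{cases}$$ Let $f(i,j)=1$ if $\tilde H_i,\tilde H_j$ commute and $f(i,j)=-1$ otherwise. For $\tau\in\{2,3,4,5\}$, a commutation pattern of size $\tau$ is a family of signs $c=(c_{ab})_{1\le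 a<b\le\tau}\in\{\pm1\}^{\tau(\tau-1)/2}$. For such a pattern let $$N_c:=\bigl|\{(i_1,\dots,i_\tau): 1\le i_1<\dots<i_\tau\le 10L,\ f(i_a,i_b)=c_{ab}\text{ for all }a<b\}\bigr| ,$$ and let $C_c\in\mathbb R$ be the fixed coefficient (depending only on $c$) $$C_c:=\sum_{w}\Bigl(1-\prod_{\substack{1\le k<l\le5\\ w_l<w_k}}c_{w_l w_k}\Bigr),$$ where $w=(w_1,\dots,w_5)$ runs over the words in $\{1,\dots,\tau\}^5$ in which every letter occurs. Then for all $t\in\mathbb R$ and all integers $r\ge1$, $$\Bigl\|\exp\Bigl(-it\sum_{j=1}^LH_j\Bigr)-\Bigl[S_4\Bigl(-\frac{it}{r}\Bigr)\Bigr]^r\Bigr\|\le\Bigl(\frac{4p-1}{2}\Lambda|t|\Bigr)^5\frac1{5!\,r^4}\sum_{\tau=2}^{5}\ \sum_{c\in\{\pm1\}^{\tau(\tau-1)/2}}C_cN_c+2\,\frac{(5(4p-1)L\Lambda t)^6}{6!\,r^5}\exp\Bigl(\frac{5(4p-1)L\Lambda|t|}{r}\Bigr).$$ -/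

import Mathlib

open scoped Matrix.Norms.L2Operator

noncomputable section

/-- The four single-qubit Pauli matrices `I, X, Y, Z`. -/
def pauliMatrix : Fin 4 → Matrix (Fin 2) (Fin 2) ℂ :=
  ![1, !![0, 1; 1, 0], !![0, -Complex.I; Complex.I, 0], !![1, 0; 0, -1]]

/-- Operators on `n` qubits, as matrices in the computational basis `{0,1}ⁿ`. The norm of such a
matrix is its spectral norm (scoped instance opened above). -/
abbrev QubitOp (n : ℕ) : Type := Matrix (Fin n → Fin 2) (Fin n → Fin 2) ℂ

/-- The tensor product of single-qubit Pauli matrices, with `P k` acting on the `k`-th qubit. -/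
def pauliString {n : ℕ} (P : Fin n → Fin 4) : QubitOp n :=
  Matrix.of fun x y => ∏ k, pauliMatrix (P k) (x k) (y k)

/-- A Hermitian Pauli-product term: a real multiple of a tensor product of Pauli matrices. -/
def IsPauliTerm {n : ℕ} (A : QubitOp n) : Prop :=
  ∃ (α : ℝ) (P : Fin n → Fin 4), A = (α : ℂ) • pauliString P

/-- The second-order formula
`S₂(μ) = exp(H₁μ/2) ⋯ exp(H_Lμ/2) · exp(H_Lμ/2) ⋯ exp(H₁μ/2)`. -/
def suzukiTwo {n L : ℕ} (H : Fin L → QubitOp n) (μ : ℂ) : QubitOp n :=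
  (List.ofFn fun j => NormedSpace.exp ((μ / 2) • H j)).prod *
    (List.ofFn fun j => NormedSpace.exp ((μ / 2) • H j)).reverse.prod

/-- `p = 1 / (4 - 4^{1/3})`. -/
def suzukiP : ℝ := 1 / (4 - (4 : ℝ) ^ ((1 : ℝ) / 3))

/-- The fourth-order formula `S₄(μ) = S₂(pμ)² S₂((1-4p)μ) S₂(pμ)²`. -/
def suzukiFour {n L : ℕ} (H : Fin L → QubitOp n) (μ : ℂ) : QubitOp n :=
  suzukiTwo H ((suzukiP : ℂ) * μ) ^ 2 * suzukiTwo H ((1 - 4 * (suzukiP : ℂ)) * μ) *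
    suzukiTwo H ((suzukiP : ℂ) * μ) ^ 2

/-- The augmented list: five copies of `H₁, …, H_L, H_L, …, H₁` (indices start at `0` here). -/
def augmentedTerms {n L : ℕ} (H : Fin L → QubitOp n) (j : Fin (10 * L)) : QubitOp n :=
  if h : (j : ℕ) % (2 * L) < L then H ⟨(j : ℕ) % (2 * L), h⟩
  else H ⟨2 * L - 1 - (j : ℕ) % (2 * L), by have := j.isLt; omega⟩

open Classical in
/-- `1` if the two operators commute and `-1` otherwise. -/
def commSign {n : ℕ} (A B : QubitOp n) : ℤˣ :=
  if A * B = B * A then 1 else -1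

/-- Pairs of positions `a < b` in a `τ`-tuple. -/
abbrev PosPair (τ : ℕ) : Type := {q : Fin τ × Fin τ // q.1 < q.2}

/-- A commutation pattern of a `τ`-tuple: a sign `±1` for every pair of positions `a < b`
(so one sign for `τ = 2`, three for `τ = 3`, six for `τ = 4` and ten for `τ = 5`). -/
abbrev CommPattern (τ : ℕ) : Type := PosPair τ → ℤˣ

/-- The number of increasing `τ`-tuples of indices in the augmented list whose pairwise
commutation signs are given by the pattern `c`. -/
def patternCount {n L : ℕ} (H : Fin L → QubitOp n) {τ : ℕ} (c : CommPattern τ) : ℕ :=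
  Set.ncard {i : Fin τ → Fin (10 * L) | StrictMono i ∧
    ∀ q : PosPair τ,
      commSign (augmentedTerms H (i q.1.1)) (augmentedTerms H (i q.1.2)) = c q}

/-- The sign produced by sorting a product `X_{w 0} X_{w 1} ⋯ X_{w 4}` into nondecreasing order of
the indices, when `X_a X_b = c(a,b) X_b X_a` for `a < b`: one factor for each inversion of `w`. -/
def sortingSign {τ : ℕ} (c : CommPattern τ) (w : Fin 5 → Fin τ) : ℤˣ :=
  ∏ q : PosPair 5, if h : w q.1.2 < w q.1.1 then c ⟨(w q.1.2, w q.1.1), h⟩ else 1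

/-- The coefficient `C_c` of the pattern `c`: the sum of `1 - sortingSign c w` over the words `w` of
length five in which each of the `τ` letters occurs. It depends on nothing but `c`. -/
def patternCoeff {τ : ℕ} (c : CommPattern τ) : ℝ :=
  ∑ w : Fin 5 → Fin τ with Function.Surjective w, (1 - ((sortingSign c w : ℤ) : ℝ))

end

/-! One step of the formula is an ordered product of N = 10L exponentials of terms `B j`, to be
compared with `exp (∑ j, B j)`. Expand both in words. At order m the exponential is 1/m! times the
sum of all products `B (w 0) ⋯ B (w (m-1))`, while the ordered product is 1/m! times the sum of the
same words sorted (`pow_sum_eq_sum_words`, `factorial_smul_coeff_prod_formalExp`). Pauli terms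
commute or anticommute, so sorting a word costs only a sign (`prod_word_eq_wordSign_smul`), and each
word contributes to the difference at most (1 - sign) times the product of the norms.

Orders below 5 cancel by Suzuki's construction (`coeff_formalFour_of_lt_five`): the choice of p
kills order 3, and time symmetry kills orders 2 and 4. At order 5, words are grouped by their set of
letters. A word with τ letters is an increasing τ-tuple composed with a surjective word on τ
symbols, and its sign depends only on the commutation pattern of the tuple; this produces
`patternCoeff` and `patternCount`. From order 6 on, both series are majorised by that of exp(Nx),
where x bounds all `‖B j‖`, which gives the remainder with its factor 2.

Finally, exact and approximate steps are unitary, so the errors of the r steps add. -/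

noncomputable section

/-! ### Sorting words in letters that commute up to sign. -/

section Words

variable {A : Type*} [Ring A] {N m : ℕ}

/-- The product `B₀ ^ k₀ * B₁ ^ k₁ * ⋯` in increasing order of the indices. -/
def sortedProd (B : Fin N → A) (k : Fin N → ℕ) : A :=
  (List.ofFn fun j => B j ^ k j).prod

/-- The multiplicities of the letters of a word. -/
def wordCount (w : Fin m → Fin N) : Fin N → ℕ := ∑ l, Pi.single (w l) 1

/-- The sign acquired when the letters of a word are sorted. -/
def wordSign (ε : Fin N → Fin N → ℤˣ) (w : Fin m → Fin N) : ℤˣ :=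
  ∏ k, ∏ l, if k < l ∧ w l < w k then ε (w l) (w k) else 1

theorem mul_pow_of_mul_eq_units_smul {x y : A} {u : ℤˣ} (h : x * y = u • (y * x)) (k : ℕ) :
    x * y ^ k = u ^ k • (y ^ k * x) := by
  induction k with
  | zero => simp
  | succ k ih =>
    rw [pow_succ, ← mul_assoc, ih, smul_mul_assoc, mul_assoc, h, mul_smul_comm, smul_smul,
      ← pow_succ, mul_assoc]

/-- The new letter moves right past the powers of all smaller letters, collecting one sign for each
factor it crosses. -/
theorem mul_sortedProd (B : Fin N → A) (ε : Fin N → Fin N → ℤˣ)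
    (h : ∀ i j, i < j → B j * B i = ε i j • (B i * B j)) (a : Fin N) (k : Fin N → ℕ) :
    B a * sortedProd B k =
      (∏ j, (if j < a then ε j a else 1) ^ k j) • sortedProd B (Pi.single a 1 + k) := by
  induction N with
  | zero => exact a.elim0
  | succ N ih =>
    simp only [sortedProd, List.ofFn_succ, List.prod_cons, Fin.prod_univ_succ]
    cases a using Fin.cases with
    | zero => simp [pow_add, mul_assoc]
    | succ a =>
      have := ih (fun i => B i.succ) (fun i j => ε i.succ j.succ)
        (fun i j hij => h _ _ (by simpa using hij)) a (fun j => k j.succ)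
      simp only [sortedProd] at this
      rw [← mul_assoc, mul_pow_of_mul_eq_units_smul (h 0 a.succ (Fin.succ_pos a)), smul_mul_assoc,
        mul_assoc, this, mul_smul_comm, smul_smul]
      simp [Fin.succ_lt_succ_iff, Pi.single_apply, Fin.succ_ne_zero, eq_comm]

theorem prod_pow_wordCount {M : Type*} [CommMonoid M] (g : Fin N → M) (w : Fin m → Fin N) :
    ∏ j, g j ^ wordCount w j = ∏ l, g (w l) := by
  simp only [wordCount, Finset.sum_apply, ← Finset.prod_pow_eq_pow_sum]
  rw [Finset.prod_comm]
  refine Finset.prod_congr rfl fun l _ => ?_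
  rw [Finset.prod_eq_single (w l)] <;> simp +contextual

theorem prod_word_eq_wordSign_smul (B : Fin N → A) (ε : Fin N → Fin N → ℤˣ)
    (h : ∀ i j, i < j → B j * B i = ε i j • (B i * B j)) (w : Fin m → Fin N) :
    (List.ofFn fun l => B (w l)).prod = wordSign ε w • sortedProd B (wordCount w) := by
  induction m with
  | zero => simp [wordSign, sortedProd, wordCount, List.ofFn_const]
  | succ m ih =>
    rw [List.ofFn_succ, List.prod_cons, ih fun l => w l.succ, mul_smul_comm,
      mul_sortedProd B ε h, smul_smul, prod_pow_wordCount]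
    congr 1
    · simp [wordSign, Fin.prod_univ_succ, Fin.succ_lt_succ_iff, mul_comm]
    · simp [wordCount, Fin.sum_univ_succ]

/-- A multiplicity vector k is shared by m!/∏ kⱼ! words. This is read off from the multinomial
theorem: (∑ Xᵢ)^m is expanded in two ways in commuting variables, and a linear map sending each
monomial X^k to `φ k` is applied. -/
theorem sum_wordCount {M : Type*} [AddCommGroup M] [Module ℂ M] (φ : (Fin N → ℕ) → M) :
    ∑ w : Fin m → Fin N, φ (wordCount w) =
      ∑ k ∈ Finset.piAntidiag Finset.univ m, (Nat.multinomial Finset.univ k : ℂ) • φ k := by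
  let F : MvPolynomial (Fin N) ℂ →ₗ[ℂ] M :=
    (MvPolynomial.basisMonomials (Fin N) ℂ).constr ℂ fun d => φ d
  have hF : ∀ d : Fin N →₀ ℕ, F (MvPolynomial.monomial d 1) = φ d := fun d => by
    have := (MvPolynomial.basisMonomials (Fin N) ℂ).constr_basis ℂ (fun d => φ d) d
    simpa using this
  have hX : ∀ k : Fin N → ℕ, ∏ i, (MvPolynomial.X i : MvPolynomial (Fin N) ℂ) ^ k i =
      MvPolynomial.monomial (Finsupp.equivFunOnFinite.symm k) 1 := fun k => by
    rw [MvPolynomial.monomial_eq, Finsupp.prod_fintype _ _ (by simp)]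
    simp
  have h1 := congrArg F (Fintype.sum_pow
    (fun i => (MvPolynomial.X i : MvPolynomial (Fin N) ℂ)) m)
  rw [Finset.sum_pow_eq_sum_piAntidiag, map_sum, map_sum] at h1
  rw [eq_comm]
  convert h1 using 2 with k hk w
  · rw [hX, ← nsmul_eq_mul, map_nsmul, hF, Nat.cast_smul_eq_nsmul]
    rfl
  · rw [← prod_pow_wordCount, hX, hF]
    rfl

theorem pow_sum_eq_sum_words (B : Fin N → A) :
    (∑ j, B j) ^ m = ∑ w : Fin m → Fin N, (List.ofFn fun l => B (w l)).prod := by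
  induction m with
  | zero => simp
  | succ m ih =>
    rw [pow_succ', ih, Finset.sum_mul_sum, ← Finset.sum_product',
      ← (Fin.consEquiv fun _ => Fin N).sum_comp]
    simp [Fin.consEquiv, List.ofFn_succ]

end Words

/-! ### Formal exponentials and the coefficients of their ordered products. -/

section FormalExp

variable {A : Type*} [Ring A] [Algebra ℂ A]

/-- The formal exponential `∑ B ^ k X ^ k / k!`. -/
def formalExp (B : A) : PowerSeries A :=
  PowerSeries.mk fun k => ((Nat.factorial k : ℂ)⁻¹) • B ^ k

@[simp]
theorem coeff_formalExp (B : A) (k : ℕ) :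
    PowerSeries.coeff k (formalExp B) = ((Nat.factorial k : ℂ)⁻¹) • B ^ k :=
  PowerSeries.coeff_mk _ _

@[simp]
theorem formalExp_zero : formalExp (0 : A) = 1 := by
  ext k
  rcases k with _ | k <;> simp [PowerSeries.coeff_one]

theorem formalExp_mul_of_commute {B C : A} (h : Commute B C) :
    formalExp B * formalExp C = formalExp (B + C) := by
  ext k
  rw [PowerSeries.coeff_mul, coeff_formalExp, h.add_pow', Finset.smul_sum]
  refine Finset.sum_congr rfl fun q hq => ?_
  obtain rfl := Finset.HasAntidiagonal.mem_antidiagonal.1 hq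
  have h1 : ((q.1 + q.2).choose q.1 : ℂ) * (q.1.factorial * q.2.factorial) =
      (q.1 + q.2).factorial := by
    exact_mod_cast by rw [← Nat.add_choose_mul_factorial_mul_factorial, Nat.choose_symm_add, mul_assoc]
  have h2 : (q.1.factorial : ℂ) ≠ 0 := by exact_mod_cast q.1.factorial_ne_zero
  have h3 : (q.2.factorial : ℂ) ≠ 0 := by exact_mod_cast q.2.factorial_ne_zero
  have h4 : ((q.1 + q.2).factorial : ℂ) ≠ 0 := by exact_mod_cast (q.1 + q.2).factorial_ne_zero
  rw [coeff_formalExp, coeff_formalExp, smul_mul_smul_comm, ← Nat.cast_smul_eq_nsmul ℂ, smul_smul]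
  congr 1
  field_simp
  linear_combination -h1

theorem coeff_prod_formalExp {N : ℕ} (B : Fin N → A) (m : ℕ) :
    PowerSeries.coeff m (List.ofFn fun j => formalExp (B j)).prod =
      ∑ k ∈ Finset.piAntidiag Finset.univ m,
        ((∏ j, ((k j).factorial : ℂ))⁻¹) • sortedProd B k := by
  induction N generalizing m with
  | zero => rcases m with _ | m <;> simp [sortedProd, PowerSeries.coeff_one]
  | succ N ih =>
    rw [List.ofFn_succ, List.prod_cons, PowerSeries.coeff_mul]
    simp only [ih, Finset.mul_sum]
    rw [Finset.sum_sigma']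
    refine Finset.sum_bij' (fun x _ => (Fin.cons x.1.1 x.2 : Fin (N + 1) → ℕ))
      (fun k _ => ⟨(k 0, ∑ j, Fin.tail k j), Fin.tail k⟩) ?_ ?_ ?_ ?_ ?_
    · rintro ⟨⟨a, b⟩, k⟩ h
      simpa [Fin.sum_univ_succ] using by aesop
    · intro k h
      have h' : k 0 + ∑ j, Fin.tail k j = m := by simpa [Fin.sum_univ_succ, Fin.tail] using h
      simpa using h'
    · rintro ⟨⟨a, b⟩, k⟩ h
      have : ∑ j, k j = b := by aesop
      simp [this]
    · intro k h
      simp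
    · rintro ⟨⟨a, b⟩, k⟩ h
      simp only [sortedProd, coeff_formalExp, List.ofFn_succ, Fin.prod_univ_succ, Fin.cons_zero,
        Fin.cons_succ, List.prod_cons, smul_mul_smul_comm, mul_inv]

/-- The weight 1/∏ kⱼ! is the multinomial coefficient divided by m!, so the sum over multiplicities
becomes a uniform sum over words, directly comparable with the expansion of (∑ Bⱼ)^m. -/
theorem factorial_smul_coeff_prod_formalExp {N : ℕ} (B : Fin N → A) (m : ℕ) :
    PowerSeries.coeff m (List.ofFn fun j => formalExp (B j)).prod =
      ((m.factorial : ℂ)⁻¹) • ∑ w : Fin m → Fin N, sortedProd B (wordCount w) := by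
  rw [coeff_prod_formalExp, sum_wordCount, Finset.smul_sum]
  refine Finset.sum_congr rfl fun k hk => ?_
  have hk' : ∑ i, k i = m := (Finset.mem_piAntidiag.1 hk).1
  have h := Nat.multinomial_spec Finset.univ k
  rw [hk'] at h
  have h4 : (m.factorial : ℂ) ≠ 0 := by exact_mod_cast m.factorial_ne_zero
  have h5 : (∏ j, ((k j).factorial : ℂ)) ≠ 0 :=
    Finset.prod_ne_zero_iff.2 fun j _ => by exact_mod_cast (k j).factorial_ne_zero
  rw [smul_smul]
  congr 1
  field_simp
  exact_mod_cast h.symm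

end FormalExp

/-! ### Leading error terms: multiplication, rescaling and time symmetry. -/

section Agreement

variable {A : Type*} [Ring A]

/-- `f` agrees with `e` below order `m`, and differs from it by `g` at order `m`. -/
def AgreesBelow (m : ℕ) (f e : PowerSeries A) (g : A) : Prop :=
  (∀ k < m, PowerSeries.coeff k f = PowerSeries.coeff k e) ∧
    PowerSeries.coeff m f = PowerSeries.coeff m e + g

theorem coeff_mul_of_coeff_eq_zero {m : ℕ} {d f : PowerSeries A}
    (hd : ∀ k < m, PowerSeries.coeff k d = 0) {k : ℕ} (hk : k ≤ m) :
    PowerSeries.coeff k (d * f) = PowerSeries.coeff k d * PowerSeries.coeff 0 f := by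
  rw [PowerSeries.coeff_mul, Finset.sum_eq_single (k, 0)]
  · rintro ⟨i, j⟩ hij hne
    have := Finset.HasAntidiagonal.mem_antidiagonal.1 hij
    have hi : i < m := by
      by_contra hi
      exact hne (by ext <;> simp at this ⊢ <;> omega)
    simp [hd i hi]
  · simp

theorem coeff_mul_of_coeff_eq_zero' {m : ℕ} {d f : PowerSeries A}
    (hd : ∀ k < m, PowerSeries.coeff k d = 0) {k : ℕ} (hk : k ≤ m) :
    PowerSeries.coeff k (f * d) = PowerSeries.coeff 0 f * PowerSeries.coeff k d := by
  rw [PowerSeries.coeff_mul, Finset.sum_eq_single (0, k)]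
  · rintro ⟨i, j⟩ hij hne
    have := Finset.HasAntidiagonal.mem_antidiagonal.1 hij
    have hj : j < m := by
      by_contra hj
      exact hne (by ext <;> simp at this ⊢ <;> omega)
    simp [hd j hj]
  · simp

/-- In f f' - e e' = (f - e) f' + e (f' - e') both differences start at order m, so at that order
only the constant terms of the other factors, equal to 1, matter: leading errors add. -/
theorem AgreesBelow.mul {m : ℕ} (hm : 0 < m) {f f' e e' : PowerSeries A} {g g' : A}
    (h : AgreesBelow m f e g) (h' : AgreesBelow m f' e' g')
    (he : PowerSeries.coeff 0 e = 1) (he' : PowerSeries.coeff 0 e' = 1) :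
    AgreesBelow m (f * f') (e * e') (g + g') := by
  have hd : ∀ k < m, PowerSeries.coeff k (f - e) = 0 := fun k hk => by simp [h.1 k hk]
  have hd' : ∀ k < m, PowerSeries.coeff k (f' - e') = 0 := fun k hk => by simp [h'.1 k hk]
  have hf' : PowerSeries.coeff 0 f' = 1 := (h'.1 0 hm).trans he'
  have key : f * f' = e * e' + ((f - e) * f' + e * (f' - e')) := by noncomm_ring
  refine ⟨fun k hk => ?_, ?_⟩
  · rw [key, map_add, map_add, coeff_mul_of_coeff_eq_zero hd hk.le,
      coeff_mul_of_coeff_eq_zero' hd' hk.le, hd k hk, hd' k hk]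
    simp
  · rw [key, map_add, map_add, coeff_mul_of_coeff_eq_zero hd le_rfl,
      coeff_mul_of_coeff_eq_zero' hd' le_rfl, hf', he]
    simp [h.2, h'.2]

/-- `f'` is obtained from `f` by the substitution of `c X` for `X`. -/
def IsRescaling [Algebra ℂ A] (c : ℂ) (f f' : PowerSeries A) : Prop :=
  ∀ k, PowerSeries.coeff k f' = c ^ k • PowerSeries.coeff k f

theorem IsRescaling.mul [Algebra ℂ A] {c : ℂ} {f f' e e' : PowerSeries A}
    (h : IsRescaling c f f') (h' : IsRescaling c e e') : IsRescaling c (f * e) (f' * e') := by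
  intro k
  rw [PowerSeries.coeff_mul, PowerSeries.coeff_mul, Finset.smul_sum]
  refine Finset.sum_congr rfl fun q hq => ?_
  rw [h, h', smul_mul_smul_comm, ← pow_add, Finset.HasAntidiagonal.mem_antidiagonal.1 hq]

theorem IsRescaling.one [Algebra ℂ A] (c : ℂ) : IsRescaling c (1 : PowerSeries A) 1 := by
  intro k
  rcases k with _ | k <;> simp [PowerSeries.coeff_one]

theorem IsRescaling.list_prod [Algebra ℂ A] {ι : Type*} (c : ℂ) {f f' : ι → PowerSeries A}
    (h : ∀ i, IsRescaling c (f i) (f' i)) (l : List ι) :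
    IsRescaling c (l.map f).prod (l.map f').prod := by
  induction l with
  | nil => exact IsRescaling.one c
  | cons i l ih => simpa using (h i).mul ih

theorem isRescaling_formalExp [Algebra ℂ A] (c : ℂ) (B : A) :
    IsRescaling c (formalExp B) (formalExp (c • B)) := by
  intro k
  rw [coeff_formalExp, coeff_formalExp, smul_pow, smul_comm]

/-- A time-symmetric formula has no error term of even order. -/
theorem AgreesBelow.eq_zero_of_symmetric [Algebra ℂ A] {m : ℕ} (hm : 0 < m) (hev : Even m)
    {f f' e e' : PowerSeries A} {g : A} (h : AgreesBelow m f e g)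
    (hf : IsRescaling (-1) f f') (he : IsRescaling (-1) e e')
    (hff : f * f' = 1) (hee : e * e' = 1) (he0 : PowerSeries.coeff 0 e = 1) : g = 0 := by
  have h' : AgreesBelow m f' e' g := by
    refine ⟨fun k hk => by rw [hf, he, h.1 k hk], ?_⟩
    rw [hf, he, h.2, hev.neg_one_pow, one_smul, one_smul]
  -- For even m the substitution X ↦ -X preserves the leading error, so f f' and e e' differ by 2g
  -- at order m; both are 1.
  have := (h.mul hm h' he0 (by rw [he, he0]; simp)).2
  rw [hff, hee, left_eq_add, ← two_smul ℂ] at this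
  exact (smul_eq_zero_iff_right two_ne_zero).1 this

end Agreement

/-! ### Time symmetry of palindromic products. -/

section Palindrome

variable {M : Type*} [Monoid M] {L : ℕ}

/-- The product `g₀ ⋯ g_{L-1} g_{L-1} ⋯ g₀`. -/
def palindromeProd (g : Fin L → M) : M := (List.ofFn g).prod * (List.ofFn g).reverse.prod

/-- Inversion reverses a product, and a palindrome is its own reversal; passing to units makes this
literal. -/
theorem palindromeProd_mul_palindromeProd_inv {g g' : Fin L → M}
    (h : ∀ j, g j * g' j = 1) (h' : ∀ j, g' j * g j = 1) :
    palindromeProd g * palindromeProd g' = 1 := by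
  let u : Fin L → Mˣ := fun j => ⟨g j, g' j, h j, h' j⟩
  have hu : ∀ v : Fin L → Mˣ, ((palindromeProd v : Mˣ) : M) = palindromeProd fun j => (v j : M) := by
    intro v
    rw [palindromeProd, palindromeProd, Units.val_mul, ← Units.coeHom_apply, ← Units.coeHom_apply,
      map_list_prod, map_list_prod]
    simp [List.map_reverse, List.map_ofFn, Function.comp_def]
  have key : palindromeProd u * palindromeProd (fun j => (u j)⁻¹) = 1 := by
    rw [mul_eq_one_iff_eq_inv, palindromeProd, palindromeProd, mul_inv_rev, List.prod_inv_reverse,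
      List.prod_inv_reverse]
    simp [List.map_reverse, List.map_ofFn, Function.comp_def]
  have := congrArg (Units.val) key
  rwa [Units.val_mul, hu, hu, Units.val_one] at this

/-- The five-fold composition underlying the fourth-order formula. -/
def suzukiProd (φ : ℂ → Fin L → M) (μ : ℂ) : M :=
  palindromeProd (φ (suzukiP * μ)) ^ 2 * palindromeProd (φ ((1 - 4 * suzukiP) * μ)) *
    palindromeProd (φ (suzukiP * μ)) ^ 2

theorem suzukiProd_mul_suzukiProd_neg {φ : ℂ → Fin L → M}
    (h : ∀ c j, φ c j * φ (-c) j = 1) (μ : ℂ) : suzukiProd φ μ * suzukiProd φ (-μ) = 1 := by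
  have key : ∀ c, palindromeProd (φ c) * palindromeProd (φ (-c)) = 1 := fun c =>
    palindromeProd_mul_palindromeProd_inv (h c) fun j => by simpa using h (-c) j
  have key2 : ∀ c x, palindromeProd (φ c) * (palindromeProd (φ (-c)) * x) = x := fun c x => by
    rw [← mul_assoc, key, one_mul]
  simp only [suzukiProd, mul_neg, pow_two, mul_assoc, key, key2]

end Palindrome

/-! ### The fourth-order formula is correct through order four. -/

section Order

variable {A : Type*} [Ring A] [Algebra ℂ A] {L : ℕ}

/-- The second-order formula as a formal series. -/
def formalTwo (H : Fin L → A) (c : ℂ) : PowerSeries A :=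
  palindromeProd fun j => formalExp ((c / 2) • H j)

/-- The fourth-order formula as a formal series. -/
def formalFour (H : Fin L → A) (μ : ℂ) : PowerSeries A :=
  suzukiProd (fun c j => formalExp ((c / 2) • H j)) μ

theorem formalExp_mul_formalExp_neg (c : ℂ) (B : A) :
    formalExp ((c / 2) • B) * formalExp ((-c / 2) • B) = 1 := by
  rw [formalExp_mul_of_commute (((Commute.refl B).smul_left _).smul_right _), ← add_smul]
  simp [neg_div]

theorem isRescaling_formalTwo (H : Fin L → A) (a c : ℂ) :
    IsRescaling c (formalTwo H a) (formalTwo H (c * a)) := by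
  have h : ∀ j, IsRescaling c (formalExp ((a / 2) • H j)) (formalExp ((c * a / 2) • H j)) :=
    fun j => by simpa [smul_smul, mul_div_assoc] using isRescaling_formalExp c ((a / 2) • H j)
  unfold formalTwo palindromeProd
  simp only [List.ofFn_eq_map, ← List.map_reverse]
  exact (IsRescaling.list_prod c h _).mul (IsRescaling.list_prod c h _)

theorem isRescaling_formalFour (H : Fin L → A) (c a : ℂ) :
    IsRescaling c (formalFour H a) (formalFour H (c * a)) := by
  have h := fun b => isRescaling_formalTwo H (b * a) c
  simp only [mul_left_comm c] at h
  simp only [formalFour, suzukiProd, pow_two]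
  exact (((h _).mul (h _)).mul (h _)).mul ((h _).mul (h _))

theorem coeff_zero_prod_formalExp (l : List A) :
    PowerSeries.coeff 0 (l.map formalExp).prod = 1 := by
  induction l with
  | nil => simp
  | cons a l ih => simp [PowerSeries.coeff_mul, ih]

theorem coeff_one_prod_formalExp (l : List A) :
    PowerSeries.coeff 1 (l.map formalExp).prod = l.sum := by
  induction l with
  | nil => simp [PowerSeries.coeff_one]
  | cons a l ih =>
    have := coeff_zero_prod_formalExp l
    simp [PowerSeries.coeff_mul, ih, Finset.Nat.antidiagonal_succ, this, add_comm]

theorem agreesBelow_three_formalTwo (H : Fin L → A) :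
    ∃ g, ∀ c, AgreesBelow 3 (formalTwo H c) (formalExp (c • ∑ j, H j)) (c ^ 3 • g) := by
  have hl : formalTwo H 1 = ((List.ofFn fun j => ((1 : ℂ) / 2) • H j) ++
      (List.ofFn fun j => ((1 : ℂ) / 2) • H j).reverse |>.map formalExp).prod := by
    simp [formalTwo, palindromeProd, List.map_ofFn, List.map_reverse, Function.comp_def]
  have h0 : PowerSeries.coeff 0 (formalTwo H 1) = 1 := by
    rw [hl, coeff_zero_prod_formalExp]
  have h1 : PowerSeries.coeff 1 (formalTwo H 1) = ∑ j, H j := by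
    rw [hl, coeff_one_prod_formalExp, List.sum_append, List.sum_reverse, List.sum_ofFn,
      ← Finset.smul_sum, ← add_smul]
    norm_num
  have hS : formalTwo H 1 * formalTwo H (-1) = 1 :=
    palindromeProd_mul_palindromeProd_inv (fun j => formalExp_mul_formalExp_neg 1 _)
      fun j => by simpa using formalExp_mul_formalExp_neg (-1) (H j)
  have hE : formalExp (∑ j, H j) * formalExp (-∑ j, H j) = 1 := by
    rw [formalExp_mul_of_commute (Commute.refl _).neg_right]
    simp
  have hA : AgreesBelow 2 (formalTwo H 1) (formalExp (∑ j, H j))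
      (PowerSeries.coeff 2 (formalTwo H 1) - PowerSeries.coeff 2 (formalExp (∑ j, H j))) := by
    refine ⟨fun k hk => ?_, by abel⟩
    interval_cases k
    · simp [h0]
    · simp [h1]
  have h2 := hA.eq_zero_of_symmetric two_pos even_two
    (by simpa using isRescaling_formalTwo H 1 (-1))
    (by simpa using isRescaling_formalExp (-1) (∑ j, H j)) hS hE (by simp)
  rw [sub_eq_zero] at h2
  refine ⟨PowerSeries.coeff 3 (formalTwo H 1) - PowerSeries.coeff 3 (formalExp (∑ j, H j)),
    fun c => ?_⟩
  have hT := isRescaling_formalTwo H 1 c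
  rw [mul_one] at hT
  have hX := isRescaling_formalExp c (∑ j, H j)
  refine ⟨fun k hk => ?_, by rw [hT, hX, smul_sub]; abel⟩
  rw [hT, hX]
  interval_cases k
  · simp [h0]
  · simp [h1]
  · rw [h2]

/-- With x = 4^{1/3}, p = 1/(4 - x) and 1 - 4p = -x/(4 - x), so the identity amounts to x³ = 4. -/
theorem suzukiP_spec : 4 * (suzukiP : ℂ) ^ 3 + (1 - 4 * (suzukiP : ℂ)) ^ 3 = 0 := by
  have h : 4 * suzukiP ^ 3 + (1 - 4 * suzukiP) ^ 3 = 0 := by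
    have h4 : ((4 : ℝ) ^ ((1 : ℝ) / 3)) ^ 3 = 4 := by
      rw [← Real.rpow_natCast, ← Real.rpow_mul (by norm_num)]
      norm_num
    rw [suzukiP]
    set x := (4 : ℝ) ^ ((1 : ℝ) / 3)
    have hx : 4 - x ≠ 0 := by
      intro hx
      rw [← sub_eq_zero.1 hx] at h4
      norm_num at h4
    field_simp
    ring_nf
    linarith
  exact_mod_cast h

theorem coeff_formalFour_of_lt_five (H : Fin L → A) (μ : ℂ) {k : ℕ} (hk : k < 5) :
    PowerSeries.coeff k (formalFour H μ) = PowerSeries.coeff k (formalExp (μ • ∑ j, H j)) := by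
  obtain ⟨g, hg⟩ := agreesBelow_three_formalTwo H
  have hadd : ∀ a b : ℂ, formalExp (a • ∑ j, H j) * formalExp (b • ∑ j, H j) =
      formalExp ((a + b) • ∑ j, H j) := fun a b => by
    rw [formalExp_mul_of_commute (((Commute.refl _).smul_left _).smul_right _), add_smul]
  have h3 : AgreesBelow 3 (formalFour H 1) (formalExp (∑ j, H j)) 0 := by
    have hm := fun {f f' a b g g'} (h : AgreesBelow 3 f (formalExp (a • ∑ j, H j)) g)
      (h' : AgreesBelow 3 f' (formalExp (b • ∑ j, H j)) g') =>
      hadd a b ▸ h.mul (by norm_num) h' (by simp) (by simp)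
    -- The cubic errors of the five stages add up to (4p³ + (1 - 4p)³) g, which vanishes.
    have := hm (hm (hm (hg (suzukiP * 1)) (hg (suzukiP * 1))) (hg ((1 - 4 * suzukiP) * 1)))
      (hm (hg (suzukiP * 1)) (hg (suzukiP * 1)))
    simp only [← add_smul] at this
    convert! this using 1
    · simp only [formalFour, formalTwo, suzukiProd, pow_two]
    · rw [show (suzukiP : ℂ) * 1 + suzukiP * 1 + (1 - 4 * suzukiP) * 1 +
        (suzukiP * 1 + suzukiP * 1) = 1 by ring, one_smul]
    · rw [eq_comm]
      convert zero_smul ℂ g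
      linear_combination suzukiP_spec
  have hA : AgreesBelow 4 (formalFour H 1) (formalExp (∑ j, H j))
      (PowerSeries.coeff 4 (formalFour H 1) - PowerSeries.coeff 4 (formalExp (∑ j, H j))) := by
    refine ⟨fun k hk => ?_, by abel⟩
    rcases Nat.lt_succ_iff_lt_or_eq.1 hk with hk | rfl
    · exact h3.1 k hk
    · simpa using h3.2
  have hE : formalExp (∑ j, H j) * formalExp (-∑ j, H j) = 1 := by
    rw [formalExp_mul_of_commute (Commute.refl _).neg_right]
    simp
  have hS : formalFour H 1 * formalFour H (-1) = 1 :=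
    suzukiProd_mul_suzukiProd_neg (fun c j => formalExp_mul_formalExp_neg c _) 1
  have h4 := hA.eq_zero_of_symmetric (by norm_num) (by decide)
    (by simpa using isRescaling_formalFour H (-1) 1)
    (by simpa using isRescaling_formalExp (-1) (∑ j, H j))
    hS hE (by simp)
  have hF := isRescaling_formalFour H μ 1
  rw [mul_one] at hF
  rw [hF, isRescaling_formalExp μ (∑ j, H j)]
  rcases Nat.lt_succ_iff_lt_or_eq.1 hk with hk | rfl
  · rw [hA.1 k hk]
  · rw [sub_eq_zero.1 h4]

end Order

/-! ### From formal series to norm estimates. -/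

section Evaluation

variable {A : Type*} [NormedRing A]

/-- The series `f` converges absolutely at `X = 1`, with sum `a`. -/
def HasEval (f : PowerSeries A) (a : A) : Prop :=
  (Summable fun k => ‖PowerSeries.coeff k f‖) ∧ ∑' k, PowerSeries.coeff k f = a

theorem HasEval.mul [CompleteSpace A] {f g : PowerSeries A} {a b : A} (hf : HasEval f a)
    (hg : HasEval g b) : HasEval (f * g) (a * b) := by
  have h1 := summable_norm_sum_mul_antidiagonal_of_summable_norm hf.1 hg.1
  have h2 := tsum_mul_tsum_eq_tsum_sum_antidiagonal_of_summable_norm hf.1 hg.1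
  rw [hf.2, hg.2] at h2
  constructor
  · simpa only [PowerSeries.coeff_mul] using h1
  · simpa only [PowerSeries.coeff_mul] using h2.symm

theorem HasEval.one : HasEval (1 : PowerSeries A) 1 := by
  have h : ∀ k ∉ ({0} : Finset ℕ), PowerSeries.coeff k (1 : PowerSeries A) = 0 := fun k hk => by
    simp_all [PowerSeries.coeff_one]
  refine ⟨summable_of_ne_finset_zero (s := {0}) fun k hk => by rw [h k hk, norm_zero], ?_⟩
  rw [tsum_eq_sum h]
  simp

theorem HasEval.list_prod [CompleteSpace A] {ι : Type*} {f : ι → PowerSeries A} {a : ι → A}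
    (h : ∀ i, HasEval (f i) (a i)) (l : List ι) : HasEval (l.map f).prod (l.map a).prod := by
  induction l with
  | nil => exact HasEval.one
  | cons i l ih => simpa using (h i).mul ih

theorem hasEval_formalExp [NormedAlgebra ℂ A] [CompleteSpace A] (B : A) :
    HasEval (formalExp B) (NormedSpace.exp B) := by
  simp only [HasEval, coeff_formalExp]
  exact ⟨NormedSpace.norm_expSeries_summable' (𝕂 := ℂ) B,
    (congrFun (NormedSpace.exp_eq_tsum ℂ) B).symm⟩

theorem tsum_pow_div_factorial_le {y : ℝ} (hy : 0 ≤ y) (m : ℕ) :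
    ∑' k, y ^ (k + m) / ((k + m).factorial : ℝ) ≤ y ^ m / m.factorial * Real.exp y := by
  have hs := Real.summable_pow_div_factorial y
  rw [Real.exp_eq_exp_ℝ, NormedSpace.exp_eq_tsum_div, ← tsum_mul_left]
  refine Summable.tsum_le_tsum (fun k => ?_) ((summable_nat_add_iff m).2 hs) (hs.mul_left _)
  rw [div_mul_div_comm, ← pow_add, add_comm m k]
  have h1 : (m.factorial : ℝ) * k.factorial ≤ (k + m).factorial := by
    rw [mul_comm]
    exact_mod_cast Nat.le_of_dvd (Nat.factorial_pos _)
      (Nat.factorial_mul_factorial_dvd_factorial_add k m)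
  have h2 : (0 : ℝ) < m.factorial * k.factorial := by positivity
  gcongr

theorem HasEval.norm_sub_sum_le [CompleteSpace A] {f : PowerSeries A} {a : A} (hf : HasEval f a)
    {y : ℝ} (hy : 0 ≤ y) (hb : ∀ k, ‖PowerSeries.coeff k f‖ ≤ y ^ k / k.factorial) (m : ℕ) :
    ‖a - ∑ k ∈ Finset.range m, PowerSeries.coeff k f‖ ≤ y ^ m / m.factorial * Real.exp y := by
  rw [← hf.2, ← hf.1.of_norm.sum_add_tsum_nat_add m, add_sub_cancel_left]
  refine le_trans (tsum_of_norm_bounded ?_ fun k => hb (k + m)) (tsum_pow_div_factorial_le hy m)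
  exact ((summable_nat_add_iff m).2 (Real.summable_pow_div_factorial y)).hasSum

theorem norm_sortedProd_wordCount_le [NormOneClass A] {N m : ℕ} {x : ℝ} (B : Fin N → A)
    (hB : ∀ j, ‖B j‖ ≤ x) (w : Fin m → Fin N) : ‖sortedProd B (wordCount w)‖ ≤ x ^ m := by
  -- The empty word is separate because it supplies no letter from which `0 ≤ x` could be deduced.
  rcases m with _ | m
  · simp [sortedProd, wordCount, List.ofFn_const]
  have hx : 0 ≤ x := (norm_nonneg _).trans (hB (w 0))
  have h : ∀ l : List (Fin N), ‖(l.map fun j => B j ^ wordCount w j).prod‖ ≤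
      (l.map fun j => x ^ wordCount w j).prod := by
    intro l
    induction l with
    | nil => simp
    | cons j l ih =>
      simp only [List.map_cons, List.prod_cons]
      exact (norm_mul_le _ _).trans (mul_le_mul ((norm_pow_le _ _).trans
        (pow_le_pow_left₀ (norm_nonneg _) (hB j) _)) ih (norm_nonneg _) (pow_nonneg hx _))
  rw [sortedProd, List.ofFn_eq_map]
  refine (h _).trans ?_
  rw [← List.ofFn_eq_map, List.prod_ofFn, prod_pow_wordCount (fun _ => x)]
  simp

/-- The difference is zero when the sign is 1 and twice the sorted product when it is -1; the factor
1 - sign covers both cases. -/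
theorem norm_sub_le_of_anticommuting [NormOneClass A] {N m : ℕ} {x : ℝ} (B : Fin N → A)
    (hB : ∀ j, ‖B j‖ ≤ x) (ε : Fin N → Fin N → ℤˣ)
    (h : ∀ i j, i < j → B j * B i = ε i j • (B i * B j)) (w : Fin m → Fin N) :
    ‖sortedProd B (wordCount w) - (List.ofFn fun l => B (w l)).prod‖ ≤
      (1 - ((wordSign ε w : ℤ) : ℝ)) * x ^ m := by
  have hn := norm_sortedProd_wordCount_le B hB w
  rw [prod_word_eq_wordSign_smul B ε h]
  rcases Int.units_eq_one_or (wordSign ε w) with hs | hs <;> rw [hs]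
  · simp
  · rw [Units.neg_smul, one_smul, sub_neg_eq_add]
    refine (norm_add_le _ _).trans ?_
    push_cast
    linarith

/-- Error of one step of a product formula whose formal series agrees with that of the exponential
of the sum below order five, in terms of the signs picked up by sorting words. -/
theorem norm_prod_exp_sub_exp_le [NormedAlgebra ℂ A] [CompleteSpace A] [NormOneClass A] {N : ℕ}
    {x : ℝ} (hx : 0 ≤ x) (B : Fin N → A)
    (hB : ∀ j, ‖B j‖ ≤ x) (ε : Fin N → Fin N → ℤˣ)
    (h : ∀ i j, i < j → B j * B i = ε i j • (B i * B j))
    (hord : ∀ k < 5, PowerSeries.coeff k (List.ofFn fun j => formalExp (B j)).prod =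
      PowerSeries.coeff k (formalExp (∑ j, B j))) :
    ‖NormedSpace.exp (∑ j, B j) - (List.ofFn fun j => NormedSpace.exp (B j)).prod‖ ≤
      x ^ 5 / (Nat.factorial 5 : ℝ) *
          ∑ w : Fin 5 → Fin N, (1 - ((wordSign ε w : ℤ) : ℝ)) +
        2 * ((N * x) ^ 6 / (Nat.factorial 6 : ℝ)) * Real.exp (N * x) := by
  have hy : 0 ≤ N * x := by positivity
  set P := (List.ofFn fun j => formalExp (B j)).prod with hP
  set E := formalExp (∑ j, B j) with hE
  have evP : HasEval P (List.ofFn fun j => NormedSpace.exp (B j)).prod := by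
    rw [hP, List.ofFn_eq_map, List.ofFn_eq_map]
    exact HasEval.list_prod (fun j => hasEval_formalExp (B j)) _
  have bE : ∀ k, ‖PowerSeries.coeff k E‖ ≤ (N * x) ^ k / k.factorial := by
    intro k
    rw [hE, coeff_formalExp, norm_smul, norm_inv, Complex.norm_natCast, inv_mul_eq_div]
    have : ‖∑ j, B j‖ ≤ N * x := by
      simpa using norm_sum_le_of_le Finset.univ fun j _ => hB j
    gcongr
    exact (norm_pow_le _ _).trans (pow_le_pow_left₀ (norm_nonneg _) this _)
  -- There are N^k words of length k, each of norm at most x^k after sorting.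
  have bP : ∀ k, ‖PowerSeries.coeff k P‖ ≤ (N * x) ^ k / k.factorial := by
    intro k
    rw [hP, factorial_smul_coeff_prod_formalExp, norm_smul, norm_inv, Complex.norm_natCast,
      inv_mul_eq_div]
    gcongr
    refine (norm_sum_le_of_le Finset.univ fun w _ =>
      norm_sortedProd_wordCount_le B hB w).trans_eq ?_
    simp [mul_pow]
  have tE := (hasEval_formalExp (∑ j, B j)).norm_sub_sum_le hy bE 6
  have tP := evP.norm_sub_sum_le hy bP 6
  have h5 : ‖PowerSeries.coeff 5 P - PowerSeries.coeff 5 E‖ ≤ x ^ 5 / (Nat.factorial 5 : ℝ) *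
      ∑ w : Fin 5 → Fin N, (1 - ((wordSign ε w : ℤ) : ℝ)) := by
    rw [hP, factorial_smul_coeff_prod_formalExp, hE, coeff_formalExp, pow_sum_eq_sum_words,
      ← smul_sub, ← Finset.sum_sub_distrib, norm_smul, norm_inv, Complex.norm_natCast,
      inv_mul_eq_div, div_mul_eq_mul_div, mul_comm (x ^ 5), Finset.sum_mul]
    gcongr
    exact norm_sum_le_of_le _ fun w _ => norm_sub_le_of_anticommuting B hB ε h w
  have hs : ∑ k ∈ Finset.range 6, PowerSeries.coeff k E -
      ∑ k ∈ Finset.range 6, PowerSeries.coeff k P =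
        -(PowerSeries.coeff 5 P - PowerSeries.coeff 5 E) := by
    rw [Finset.sum_range_succ, Finset.sum_range_succ _ 5,
      Finset.sum_congr rfl fun k hk => hord k (Finset.mem_range.1 hk)]
    abel
  have key : NormedSpace.exp (∑ j, B j) - (List.ofFn fun j => NormedSpace.exp (B j)).prod =
      -(PowerSeries.coeff 5 P - PowerSeries.coeff 5 E) +
      ((NormedSpace.exp (∑ j, B j) - ∑ k ∈ Finset.range 6, PowerSeries.coeff k E) -
      ((List.ofFn fun j => NormedSpace.exp (B j)).prod -
        ∑ k ∈ Finset.range 6, PowerSeries.coeff k P)) := by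
    rw [← hs]
    abel
  rw [key]
  refine (norm_add_le _ _).trans ?_
  rw [norm_neg]
  refine add_le_add h5 ((norm_sub_le _ _).trans ?_)
  linarith

/-- Telescoping: each replacement of a factor costs `‖a - b‖`, since the remaining factors are
contractions. -/
theorem norm_pow_sub_pow_le_mul [NormOneClass A] {a b : A} (ha : ‖a‖ ≤ 1) (hb : ‖b‖ ≤ 1) (r : ℕ) :
    ‖a ^ r - b ^ r‖ ≤ r * ‖a - b‖ := by
  induction r with
  | zero => simp
  | succ r ih =>
    have : a ^ (r + 1) - b ^ (r + 1) = a ^ r * (a - b) + (a ^ r - b ^ r) * b := by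
      rw [pow_succ, pow_succ]
      noncomm_ring
    rw [this]
    have h1 : ‖a ^ r * (a - b)‖ ≤ 1 * ‖a - b‖ := (norm_mul_le _ _).trans (by
      gcongr
      exact (norm_pow_le _ _).trans (pow_le_one₀ (norm_nonneg _) ha))
    have h2 : ‖(a ^ r - b ^ r) * b‖ ≤ (r * ‖a - b‖) * 1 := (norm_mul_le _ _).trans (by gcongr)
    refine (norm_add_le _ _).trans ?_
    push_cast
    linarith

end Evaluation

/-! ### Grouping words by commutation pattern. -/

section Patterns

variable {N τ : ℕ}

/-- The commutation pattern of a tuple of indices. -/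
def tuplePattern (ε : Fin N → Fin N → ℤˣ) (i : Fin τ → Fin N) : CommPattern τ :=
  fun q => ε (i q.1.1) (i q.1.2)

/-- A strictly increasing relabelling of the letters preserves inversions. -/
theorem wordSign_comp (ε : Fin N → Fin N → ℤˣ) {i : Fin τ → Fin N} (hi : StrictMono i)
    (u : Fin 5 → Fin τ) : wordSign ε (i ∘ u) = sortingSign (tuplePattern ε i) u := by
  have h : sortingSign (tuplePattern ε i) u = ∏ q : PosPair 5,
      if u q.1.2 < u q.1.1 then ε (i (u q.1.2)) (i (u q.1.1)) else 1 := by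
    refine Finset.prod_congr rfl fun q _ => ?_
    split_ifs <;> rfl
  rw [h, wordSign, ← Fintype.prod_prod_type']
  rw [← Finset.prod_subtype (Finset.univ.filter fun q : Fin 5 × Fin 5 => q.1 < q.2) (by simp)
    (fun q => if u q.2 < u q.1 then ε (i (u q.2)) (i (u q.1)) else 1), Finset.prod_filter]
  refine Finset.prod_congr rfl fun q _ => ?_
  simp only [Function.comp_apply, hi.lt_iff_lt, ite_and]

theorem one_sub_wordSign_nonneg (ε : Fin N → Fin N → ℤˣ) {m : ℕ} (w : Fin m → Fin N) :
    0 ≤ 1 - ((wordSign ε w : ℤ) : ℝ) := by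
  rcases Int.units_eq_one_or (wordSign ε w) with h | h <;> simp [h]

/-- Since the summands are nonnegative, it suffices that every word with τ letters factors as `i ∘
u`; uniqueness of the factorisation is not needed for the inequality. -/
theorem sum_words_of_card_image_le (ε : Fin N → Fin N → ℤˣ) (τ : ℕ) :
    ∑ w : Fin 5 → Fin N with (Finset.univ.image w).card = τ, (1 - ((wordSign ε w : ℤ) : ℝ)) ≤
      ∑ i : Fin τ → Fin N with StrictMono i, patternCoeff (tuplePattern ε i) := by
  classical
  have h : ∑ i : Fin τ → Fin N with StrictMono i, patternCoeff (tuplePattern ε i) =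
      ∑ q ∈ (Finset.univ.filter fun i : Fin τ → Fin N => StrictMono i) ×ˢ
        (Finset.univ.filter fun u : Fin 5 → Fin τ => Function.Surjective u),
        (1 - ((wordSign ε (q.1 ∘ q.2) : ℤ) : ℝ)) := by
    rw [Finset.sum_product]
    refine Finset.sum_congr rfl fun i hi => ?_
    rw [patternCoeff]
    refine Finset.sum_congr (by congr) fun u _ => ?_
    rw [wordSign_comp ε (Finset.mem_filter.1 hi).2]
  rw [h]
  refine le_trans (Finset.sum_le_sum_of_subset_of_nonneg ?_ fun w _ _ => one_sub_wordSign_nonneg ε w)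
    (Finset.sum_image_le_of_nonneg (g := fun q : (Fin τ → Fin N) × (Fin 5 → Fin τ) => q.1 ∘ q.2)
      (f := fun w => 1 - ((wordSign ε w : ℤ) : ℝ)) fun w _ => one_sub_wordSign_nonneg ε w)
  intro w hw
  have hc : (Finset.univ.image w).card = τ := (Finset.mem_filter.1 hw).2
  -- The increasing enumeration of the letters is the tuple; the rank of each letter gives the
  -- surjective word.
  let e := (Finset.univ.image w).orderIsoOfFin hc
  have hmem : ∀ l, w l ∈ Finset.univ.image w := fun l => by simp
  refine Finset.mem_image.2 ⟨(fun a => (e a : Fin N), fun l => e.symm ⟨w l, hmem l⟩), ?_, ?_⟩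
  · simp only [Finset.mem_product, Finset.mem_filter, Finset.mem_univ, true_and]
    refine ⟨fun a b hab => e.strictMono hab, fun a => ?_⟩
    obtain ⟨l, -, hl⟩ := Finset.mem_image.1 (e a).2
    exact ⟨l, by simp [hl]⟩
  · ext l
    simp

theorem sum_words_le (ε : Fin N → Fin N → ℤˣ) :
    ∑ w : Fin 5 → Fin N, (1 - ((wordSign ε w : ℤ) : ℝ)) ≤
      (∑ i : Fin 2 → Fin N with StrictMono i, patternCoeff (tuplePattern ε i)) +
      (∑ i : Fin 3 → Fin N with StrictMono i, patternCoeff (tuplePattern ε i)) +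
      (∑ i : Fin 4 → Fin N with StrictMono i, patternCoeff (tuplePattern ε i)) +
      (∑ i : Fin 5 → Fin N with StrictMono i, patternCoeff (tuplePattern ε i)) := by
  have hmap : ∀ w ∈ (Finset.univ : Finset (Fin 5 → Fin N)),
      (Finset.univ.image w).card ∈ Finset.range 6 := fun w _ => by
    have := Finset.card_image_le (s := Finset.univ) (f := w)
    simp at this ⊢
    omega
  rw [← Finset.sum_fiberwise_of_maps_to hmap]
  have h0 : ∑ w : Fin 5 → Fin N with (Finset.univ.image w).card = 0,
      (1 - ((wordSign ε w : ℤ) : ℝ)) = 0 := by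
    rw [Finset.filter_false_of_mem, Finset.sum_empty]
    intro w _
    simp [Finset.univ_nonempty.ne_empty]
  -- A constant word has no inversions, which is why the pattern sizes start at 2.
  have h1 : ∑ w : Fin 5 → Fin N with (Finset.univ.image w).card = 1,
      (1 - ((wordSign ε w : ℤ) : ℝ)) = 0 := by
    refine Finset.sum_eq_zero fun w hw => ?_
    obtain ⟨a, ha⟩ := Finset.card_eq_one.1 (Finset.mem_filter.1 hw).2
    have hw : ∀ l, w l = a := fun l => by
      have : w l ∈ Finset.univ.image w := by simp
      simpa [ha] using this
    simp [wordSign, hw]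
  have h := sum_words_of_card_image_le ε
  simp only [Finset.sum_range_succ, Finset.sum_range_zero, h0, h1, zero_add]
  linarith [h 2, h 3, h 4, h 5]

theorem sum_patternCoeff_eq {n L : ℕ} (H : Fin L → QubitOp n) (τ : ℕ) :
    ∑ i : Fin τ → Fin (10 * L) with StrictMono i, patternCoeff
        (tuplePattern (fun a b => commSign (augmentedTerms H a) (augmentedTerms H b)) i) =
      ∑ c : CommPattern τ, patternCoeff c * (patternCount H c : ℝ) := by
  classical
  rw [← Finset.sum_fiberwise _ (tuplePattern
    (fun a b => commSign (augmentedTerms H a) (augmentedTerms H b)))]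
  refine Finset.sum_congr rfl fun c _ => ?_
  rw [Finset.sum_congr rfl (g := fun _ => patternCoeff c)
    fun i hi => by rw [(Finset.mem_filter.1 hi).2], Finset.sum_const, nsmul_eq_mul, mul_comm,
    patternCount, Set.ncard_eq_toFinset_card', Finset.filter_filter]
  congr 3
  ext i
  simp [tuplePattern, funext_iff]

end Patterns

/-! ### Pauli terms are self-adjoint and commute up to sign. -/

section Pauli

variable {n : ℕ}

theorem pauliMatrix_mul_comm (a b : Fin 4) : ∃ s : ℤˣ,
    pauliMatrix a * pauliMatrix b = s • (pauliMatrix b * pauliMatrix a) := by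
  have h : pauliMatrix a * pauliMatrix b = pauliMatrix b * pauliMatrix a ∨
      pauliMatrix a * pauliMatrix b = -(pauliMatrix b * pauliMatrix a) := by
    fin_cases a <;> fin_cases b <;> simp [pauliMatrix]
  rcases h with h | h
  · exact ⟨1, by rw [h, one_smul]⟩
  · exact ⟨-1, by rw [h, Units.neg_smul, one_smul]⟩

theorem pauliString_mul (P Q : Fin n → Fin 4) : pauliString P * pauliString Q =
    Matrix.of fun x y => ∏ k, (pauliMatrix (P k) * pauliMatrix (Q k)) (x k) (y k) := by
  ext x y
  simp only [pauliString, Matrix.mul_apply, Matrix.of_apply, ← Finset.prod_mul_distrib]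
  rw [Finset.prod_univ_sum, Fintype.piFinset_univ]

/-- Products of strings are formed qubit by qubit, so the single-qubit signs multiply. -/
theorem pauliString_mul_comm (P Q : Fin n → Fin 4) : ∃ s : ℤˣ,
    pauliString P * pauliString Q = s • (pauliString Q * pauliString P) := by
  choose s hs using fun k => pauliMatrix_mul_comm (P k) (Q k)
  refine ⟨∏ k, s k, ?_⟩
  rw [pauliString_mul, pauliString_mul]
  ext x y
  simp only [hs, Matrix.of_apply, Matrix.smul_apply, Units.smul_def, zsmul_eq_mul,
    Finset.prod_mul_distrib]
  push_cast
  rfl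

theorem IsPauliTerm.mul_comm_eq {A B : QubitOp n} (hA : IsPauliTerm A) (hB : IsPauliTerm B) :
    B * A = commSign A B • (A * B) := by
  obtain ⟨a, P, rfl⟩ := hA
  obtain ⟨b, Q, rfl⟩ := hB
  obtain ⟨s, hs⟩ := pauliString_mul_comm Q P
  have h : ((b : ℂ) • pauliString Q) * ((a : ℂ) • pauliString P) =
      s • (((a : ℂ) • pauliString P) * ((b : ℂ) • pauliString Q)) := by
    rw [smul_mul_smul_comm, hs, smul_mul_smul_comm, mul_comm, smul_comm]
  unfold commSign
  split_ifs with hc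
  · rw [hc, one_smul]
  · rcases Int.units_eq_one_or s with rfl | rfl
    · exact absurd (by rw [h, one_smul]) hc
    · exact h

theorem pauliMatrix_conjTranspose (a : Fin 4) : (pauliMatrix a).conjTranspose = pauliMatrix a := by
  fin_cases a <;> ext i j <;> fin_cases i <;> fin_cases j <;> simp [pauliMatrix]

theorem IsPauliTerm.isSelfAdjoint {A : QubitOp n} (hA : IsPauliTerm A) : IsSelfAdjoint A := by
  obtain ⟨a, P, rfl⟩ := hA
  refine IsSelfAdjoint.smul (by simp [isSelfAdjoint_iff]) ?_
  rw [isSelfAdjoint_iff, Matrix.star_eq_conjTranspose]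
  ext x y
  simp only [pauliString, Matrix.conjTranspose_apply, Matrix.of_apply, star_prod]
  refine Finset.prod_congr rfl fun k _ => ?_
  rw [← Matrix.conjTranspose_apply, pauliMatrix_conjTranspose]

end Pauli

/-! ### The fourth-order formula as a single product over the augmented list. -/

section Augmented

/-- The coefficient, relative to `μ / 2`, of the `j`-th exponential in the fourth-order formula. -/
def stageWeight (L j : ℕ) : ℝ := if j / (L + L) = 2 then 1 - 4 * suzukiP else suzukiP

theorem augmentedTerms_eq {n L : ℕ} (H : Fin L → QubitOp n) (j : Fin (10 * L)) :
    ∃ i, augmentedTerms H j = H i := by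
  unfold augmentedTerms
  split_ifs <;> exact ⟨_, rfl⟩

/-- Division of the index by 2L gives the stage as quotient and the place in the palindrome as
remainder. The map φ is arbitrary so that the result serves both formal and actual exponentials. -/
theorem prod_ofFn_augmentedTerms {M : Type*} [Monoid M] {n L : ℕ} (H : Fin L → QubitOp n)
    (φ : ℂ → QubitOp n → M) (μ : ℂ) :
    (List.ofFn fun j : Fin (10 * L) =>
      φ ((stageWeight L j : ℂ) * μ) (augmentedTerms H j)).prod =
      suzukiProd (fun c j => φ c (H j)) μ := by
  have hblock : ∀ (a : ℕ) (c : ℂ) (f : Fin (L + L) → Fin (10 * L)),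
      (∀ j, (f j : ℕ) = a * (L + L) + j) → (if a = 2 then 1 - 4 * suzukiP else suzukiP : ℝ) = c →
      (List.ofFn fun j => φ ((stageWeight L (f j) : ℂ) * μ) (augmentedTerms H (f j))).prod =
        palindromeProd fun j => φ (c * μ) (H j) := by
    intro a c f hf hc
    have hw : ∀ j, (stageWeight L (f j) : ℂ) = c := fun j => by
      have hpos : 0 < L + L := by have := j.isLt; omega
      rw [← hc, stageWeight, hf, Nat.add_comm, Nat.add_mul_div_right _ _ hpos,
        Nat.div_eq_of_lt j.isLt, zero_add]
    have hm : ∀ j, (f j : ℕ) % (2 * L) = j := fun j => by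
      rw [hf, two_mul, Nat.add_comm, Nat.add_mul_mod_self_right, Nat.mod_eq_of_lt j.isLt]
    simp only [hw]
    rw [List.ofFn_add, List.prod_append, palindromeProd]
    congr 2
    · congr 1
      funext j
      congr 1
      simp [augmentedTerms, hm]
    · refine List.ext_getElem (by simp) fun k h1 h2 => ?_
      have hk : k < L := by simpa using h1
      simp only [List.getElem_ofFn, List.getElem_reverse, List.length_ofFn]
      congr 1
      simp only [augmentedTerms, hm]
      rw [dif_neg (by simp)]
      congr 2
      simp
      omega
  have hN : 10 * L = 5 * (L + L) := by ring
  rw [List.ofFn_congr hN, List.ofFn_mul]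
  have key := fun (i : Fin 5) (c : ℂ) => hblock i c
    (fun j => ⟨(i : ℕ) * (L + L) + j, by
      have h1 := j.isLt
      have h2 := i.isLt
      nlinarith⟩) fun j => rfl
  have hrows : (fun i : Fin 5 => (List.ofFn fun j : Fin (L + L) =>
      φ ((stageWeight L ((i : ℕ) * (L + L) + j) : ℂ) * μ) (augmentedTerms H
        ⟨(i : ℕ) * (L + L) + j, by
          have h1 := j.isLt
          have h2 := i.isLt
          nlinarith⟩)).prod) = fun i : Fin 5 => palindromeProd fun j =>
        φ (((if (i : ℕ) = 2 then 1 - 4 * suzukiP else suzukiP : ℝ) : ℂ) * μ) (H j) :=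
    funext fun i => key i _ rfl
  rw [List.prod_flatten, List.map_ofFn]
  refine (congrArg (fun g => (List.ofFn g).prod) hrows).trans ?_
  simp [List.ofFn_succ, suzukiProd, pow_two, mul_assoc]

end Augmented

/-! ### One-step bound, unitarity and the final estimate. -/

section Main

/-- Since 4^{1/3} ≥ 1, p ≥ 1/3. Hence the backward middle stage, of length 4p - 1, is the longest,
and this length governs all the norms. -/
theorem suzukiP_bounds : 0 < suzukiP ∧ suzukiP ≤ 4 * suzukiP - 1 := by
  have h1 : (4 : ℝ) ^ ((1 : ℝ) / 3) < 4 := by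
    simpa using Real.rpow_lt_rpow_of_exponent_lt (x := 4) (by norm_num)
      (show (1 : ℝ) / 3 < 1 by norm_num)
  have h2 : 1 ≤ (4 : ℝ) ^ ((1 : ℝ) / 3) := Real.one_le_rpow (by norm_num) (by norm_num)
  have h3 : 0 < 4 - (4 : ℝ) ^ ((1 : ℝ) / 3) := by linarith
  have h4 : 0 < suzukiP := by rw [suzukiP]; positivity
  refine ⟨h4, ?_⟩
  have : suzukiP * (4 - (4 : ℝ) ^ ((1 : ℝ) / 3)) = 1 := by rw [suzukiP]; field_simp
  nlinarith

theorem abs_stageWeight_le (L j : ℕ) : |stageWeight L j| ≤ 4 * suzukiP - 1 := by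
  obtain ⟨h1, h2⟩ := suzukiP_bounds
  unfold stageWeight
  split_ifs
  · rw [abs_of_nonpos] <;> linarith
  · rwa [abs_of_pos h1]

theorem exp_smul_mem_unitary {n : ℕ} {A : QubitOp n} (hA : IsSelfAdjoint A) {μ : ℂ}
    (hμ : μ.re = 0) : NormedSpace.exp (μ • A) ∈ unitary (QubitOp n) := by
  let := NormedAlgebra.restrictScalars ℚ ℂ (QubitOp n)
  apply NormedSpace.exp_mem_unitary_of_mem_skewAdjoint
  refine hA.smul_mem_skewAdjoint ?_
  rw [skewAdjoint.mem_iff]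
  apply Complex.ext <;> simp [hμ]

theorem norm_suzukiFour_step_le {n L : ℕ} (H : Fin L → QubitOp n) (hH : ∀ j, IsPauliTerm (H j))
    {Λ : ℝ} (hΛ : ∀ j, ‖H j‖ ≤ Λ) (hΛ0 : 0 ≤ Λ) (μ : ℂ) :
    ‖NormedSpace.exp (μ • ∑ j, H j) - suzukiFour H μ‖ ≤
      ((4 * suzukiP - 1) / 2 * Λ * ‖μ‖) ^ 5 / (Nat.factorial 5 : ℝ) *
          ((∑ a : CommPattern 2, patternCoeff a * (patternCount H a : ℝ)) +
            (∑ b : CommPattern 3, patternCoeff b * (patternCount H b : ℝ)) +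
            (∑ c : CommPattern 4, patternCoeff c * (patternCount H c : ℝ)) +
            (∑ d : CommPattern 5, patternCoeff d * (patternCount H d : ℝ))) +
        2 * ((5 * (4 * suzukiP - 1) * (L : ℝ) * Λ * ‖μ‖) ^ 6 / (Nat.factorial 6 : ℝ)) *
          Real.exp (5 * (4 * suzukiP - 1) * (L : ℝ) * Λ * ‖μ‖) := by
  obtain ⟨hp1, hp2⟩ := suzukiP_bounds
  have hp : 0 ≤ 4 * suzukiP - 1 := by linarith
  set x := (4 * suzukiP - 1) / 2 * Λ * ‖μ‖ with hx
  have hx0 : 0 ≤ x := by positivity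
  let B : Fin (10 * L) → QubitOp n := fun j =>
    (((stageWeight L j : ℂ) * μ) / 2) • augmentedTerms H j
  have hB : ∀ j, ‖B j‖ ≤ x := fun j => by
    obtain ⟨i, hi⟩ := augmentedTerms_eq H j
    simp only [B, norm_smul, norm_div, norm_mul, Complex.norm_real, Real.norm_eq_abs, hi]
    have h1 := abs_stageWeight_le L j
    have h2 := hΛ i
    calc _ ≤ (4 * suzukiP - 1) * ‖μ‖ / ‖(2 : ℂ)‖ * Λ := by gcongr
      _ = x := by rw [hx]; simp; ring
  let ε : Fin (10 * L) → Fin (10 * L) → ℤˣ := fun a b =>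
    commSign (augmentedTerms H a) (augmentedTerms H b)
  have hT : ∀ j, IsPauliTerm (augmentedTerms H j) := fun j => by
    obtain ⟨i, hi⟩ := augmentedTerms_eq H j
    exact hi ▸ hH i
  have hε : ∀ i j, i < j → B j * B i = ε i j • (B i * B j) := fun i j _ => by
    simp only [B, ε]
    rw [smul_mul_smul_comm, (hT i).mul_comm_eq (hT j), smul_mul_smul_comm, smul_comm, mul_comm]
  have hformal : (List.ofFn fun j => formalExp (B j)).prod = formalFour H μ :=
    prod_ofFn_augmentedTerms H (fun c A => formalExp ((c / 2) • A)) μ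
  have hexp : (List.ofFn fun j => NormedSpace.exp (B j)).prod = suzukiFour H μ :=
    prod_ofFn_augmentedTerms H (fun c A => NormedSpace.exp ((c / 2) • A)) μ
  -- The first-order coefficient of the product is the sum of its exponents, so first-order
  -- correctness gives this without adding up the stage weights.
  have hsum : ∑ j, B j = μ • ∑ j, H j := by
    have h := coeff_formalFour_of_lt_five H μ (k := 1) (by norm_num)
    have hmap : (List.ofFn fun j => formalExp (B j)) = (List.ofFn B).map formalExp := by
      rw [List.map_ofFn]
      rfl
    rw [← hformal, hmap, coeff_one_prod_formalExp] at h
    simpa [List.sum_ofFn] using h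
  have h := norm_prod_exp_sub_exp_le hx0 B hB ε hε fun k hk => by
    rw [hformal, hsum, coeff_formalFour_of_lt_five H μ hk]
  rw [hexp, hsum] at h
  refine h.trans ?_
  have hNx : ((10 * L : ℕ) : ℝ) * x = 5 * (4 * suzukiP - 1) * (L : ℝ) * Λ * ‖μ‖ := by
    rw [hx]
    push_cast
    ring
  rw [hNx]
  gcongr
  rw [← sum_patternCoeff_eq, ← sum_patternCoeff_eq, ← sum_patternCoeff_eq, ← sum_patternCoeff_eq]
  exact sum_words_le ε

theorem palindromeProd_mem {M : Type*} [Monoid M] (S : Submonoid M) {L : ℕ} {g : Fin L → M}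
    (h : ∀ j, g j ∈ S) : palindromeProd g ∈ S := by
  refine S.mul_mem (S.list_prod_mem ?_) (S.list_prod_mem ?_) <;> simpa using h

theorem mainTheorem7 (n L : ℕ) (H : Fin L → QubitOp n) (hH : ∀ j, IsPauliTerm (H j))
    (Λ : ℝ) (hΛ : Λ = ⨆ j, ‖H j‖) (t : ℝ) (r : ℕ) (hr : 1 ≤ r) :
    ‖NormedSpace.exp ((-Complex.I * (t : ℂ)) • ∑ j, H j) -
        suzukiFour H (-Complex.I * (t : ℂ) / (r : ℂ)) ^ r‖ ≤
      ((4 * suzukiP - 1) / 2 * Λ * |t|) ^ 5 * (1 / ((Nat.factorial 5 : ℝ) * (r : ℝ) ^ 4)) *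
          ((∑ a : CommPattern 2, patternCoeff a * (patternCount H a : ℝ)) +
            (∑ b : CommPattern 3, patternCoeff b * (patternCount H b : ℝ)) +
            (∑ c : CommPattern 4, patternCoeff c * (patternCount H c : ℝ)) +
            (∑ d : CommPattern 5, patternCoeff d * (patternCount H d : ℝ))) +
        2 * ((5 * (4 * suzukiP - 1) * (L : ℝ) * Λ * t) ^ 6 /
            ((Nat.factorial 6 : ℝ) * (r : ℝ) ^ 5)) *
          Real.exp (5 * (4 * suzukiP - 1) * (L : ℝ) * Λ * |t| / (r : ℝ)) := by
  have hr0 : (r : ℝ) ≠ 0 := by positivity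
  have hrC : (r : ℂ) ≠ 0 := by exact_mod_cast hr0
  -- For L = 0 the supremum of the empty family of reals is 0, as the convention for Λ requires.
  have hΛ0 : 0 ≤ Λ := hΛ ▸ Real.iSup_nonneg fun j => norm_nonneg _
  have hΛj : ∀ j, ‖H j‖ ≤ Λ := fun j => hΛ ▸
    le_ciSup (f := fun j => ‖H j‖) (Set.finite_range _).bddAbove j
  set μ : ℂ := -Complex.I * (t : ℂ) / (r : ℂ) with hμ
  have hre : ∀ c : ℝ, ((c : ℂ) * μ / 2).re = 0 := fun c => by
    have : (c : ℂ) * μ / 2 = ((-(c * t / r / 2) : ℝ) : ℂ) * Complex.I := by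
      rw [hμ]
      push_cast
      ring
    rw [this, Complex.re_ofReal_mul]
    simp
  have hnorm : ‖μ‖ = |t| / r := by simp [hμ]
  have hself : IsSelfAdjoint (∑ j, H j) := isSelfAdjoint_sum _ fun j _ => (hH j).isSelfAdjoint
  have hE : NormedSpace.exp (μ • ∑ j, H j) ∈ unitary (QubitOp n) :=
    exp_smul_mem_unitary hself (by simpa using hre 2)
  have hstage : ∀ c : ℝ, suzukiTwo H ((c : ℂ) * μ) ∈ unitary (QubitOp n) := fun c =>
    palindromeProd_mem _ fun j => exp_smul_mem_unitary (hH j).isSelfAdjoint (hre c)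
  have hS : suzukiFour H μ ∈ unitary (QubitOp n) := by
    have h1 := hstage suzukiP
    have h2 := hstage (1 - 4 * suzukiP)
    push_cast at h2
    exact mul_mem (mul_mem (pow_mem h1 2) h2) (pow_mem h1 2)
  have hpow : NormedSpace.exp ((-Complex.I * (t : ℂ)) • ∑ j, H j) =
      NormedSpace.exp (μ • ∑ j, H j) ^ r := by
    let := NormedAlgebra.restrictScalars ℚ ℂ (QubitOp n)
    rw [← NormedSpace.exp_nsmul, ← Nat.cast_smul_eq_nsmul ℂ, smul_smul, hμ, mul_div_cancel₀ _ hrC]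
  rw [hpow]
  refine (norm_pow_sub_pow_le_mul (CStarRing.norm_of_mem_unitary hE).le
    (CStarRing.norm_of_mem_unitary hS).le r).trans ?_
  refine (mul_le_mul_of_nonneg_left (norm_suzukiFour_step_le H hH hΛj hΛ0 μ)
    (Nat.cast_nonneg r)).trans_eq ?_
  -- With `‖μ‖ = |t| / r`, the factor r from the r steps turns r⁻⁵ and r⁻⁶ into r⁻⁴ and r⁻⁵; the
  -- even power lets t replace |t| in the remainder.
  rw [hnorm, mul_pow _ t, ← Even.pow_abs (by decide : Even 6) t]
  rw [show 5 * (4 * suzukiP - 1) * (L : ℝ) * Λ * (|t| / r) =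
    5 * (4 * suzukiP - 1) * (L : ℝ) * Λ * |t| / r by ring]
  field_simp

end Main
end
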